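/- Let $\mathbb{F}_q$ be a finite field with $q$ elements, let $m\ge 1$ and $k\ge 0$ be integers, let $R=M_m(\mathbb{F}_q)$ be the ring of $m\times m$ matrices over $\mathbb{F}_q$, and let $A=M_{m\times k}(\mathbb{F}_q)$, regarded as a left $R$-module by matrix multiplication. A (linear) code of length $n$ over $A$ is a left $R$-submodule $C\subseteq A^n$. An $R$-linear map $f\colon C\to A^n$ is a Hamming isometry if it preserves the Hamming distance (the number of coordinates in which two elements of $A^n$ differ). An $R$-linear map $h\colon A^n\to A^n$ is monomial if there are a permutation $\pi\in S_n$ and automorphisms $g_1,\dots,g_n\in\operatorname{Aut}_R(A)$ such that $h(a_1,\dots,a_n)=(g_1(a_{\pi(1)}),\dots,g_n(a_{\pi(n)}))$ for all $(a_1,\dots,a_n)\in A^n$; the map $f$ extends to a monomial map (is extendable) if $f=h|_C$ for some monomial $h$. The alphabet $A$ has the extension property if for every positive integer $n$ and every code $C\subseteq A^n$, each $R$-linear Hamming isometry $f\colon C\to A^n$ extends to a monomial map. Put $N=\prod_{i=1}^{m}(1+q^i)$. Then: 1. If $k\le m$, then $A$ has the extension property. 2. If $k>m$, then there exist a code $C\subseteq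 A^N$ and an $R$-linear Hamming isometry $f\colon C\to A^N$ that does not extend to a monomial map. 3. For every $n<N$ and every code $C\subseteq A^n$, each $R$-linear Hamming isometry $f\colon C\to A^n$ extends to a monomial map. Consequently, if $k>m$, then $N$ is the minimum of all lengths $n$ for which there exist a code $C\subseteq A^n$ and an $R$-linear Hamming isometry $C\to A^n$ that does not extend to a monomial map. -/

import Mathlib

namespace MatrixModuleCode

section General

variable {R A : Type*} [Ring R] [AddCommGroup A] [Module R A]

/-- An `R`-linear endomorphism `h` of `A ^ n` is monomial if there are a permutation `π` and
automorphisms `g 1, …, g n` of the `R`-module `A` with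
`h (a 1, …, a n) = (g 1 (a (π 1)), …, g n (a (π n)))`. -/
def IsMonomial {n : ℕ} (h : (Fin n → A) →ₗ[R] (Fin n → A)) : Prop :=
  ∃ (π : Equiv.Perm (Fin n)) (g : Fin n → (A ≃ₗ[R] A)),
    ∀ (a : Fin n → A) (i : Fin n), h a i = g i (a (π i))

open Classical in
/-- An `R`-linear map from a code `C ⊆ A ^ n` to `A ^ n` is a Hamming isometry if it preserves the
Hamming distance. -/
def IsHammingIsometry {n : ℕ} {C : Submodule R (Fin n → A)} (f : C →ₗ[R] (Fin n → A)) : Prop :=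
  ∀ x y : C, hammingDist (f x) (f y) = hammingDist (x : Fin n → A) (y : Fin n → A)

/-- The map `f`, defined on the code `C ⊆ A ^ n`, extends to a monomial map of `A ^ n`. -/
def ExtendsToMonomial {n : ℕ} {C : Submodule R (Fin n → A)} (f : C →ₗ[R] (Fin n → A)) : Prop :=
  ∃ h : (Fin n → A) →ₗ[R] (Fin n → A), IsMonomial h ∧ ∀ c : C, h (c : Fin n → A) = f c

variable (R A) in
/-- The alphabet `A` has the extension property: for every positive length `n` and every linear
code `C ⊆ A ^ n`, each linear Hamming isometry `C → A ^ n` extends to a monomial map. -/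
def HasExtensionProperty : Prop :=
  ∀ n : ℕ, 0 < n → ∀ (C : Submodule R (Fin n → A)) (f : C →ₗ[R] (Fin n → A)),
    IsHammingIsometry f → ExtendsToMonomial f

end General

/-- The `m × k` matrices as a left module over the ring of `m × m` matrices, by matrix
multiplication. -/
instance matrixLeftModule (F : Type*) [Field F] (m k : ℕ) :
    Module (Matrix (Fin m) (Fin m) F) (Matrix (Fin m) (Fin k) F) where
  smul r a := r * a
  one_smul a := Matrix.one_mul a
  mul_smul r s a := Matrix.mul_assoc r s a
  smul_zero r := Matrix.mul_zero r
  smul_add r a b := Matrix.mul_add r a b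
  add_smul r s a := Matrix.add_mul r s a
  zero_smul a := Matrix.zero_mul a

/-- `N = ∏_{i=1}^{m} (1 + q ^ i)`. -/
def minLength (q m : ℕ) : ℕ := ∏ i ∈ Finset.Icc 1 m, (1 + q ^ i)

end MatrixModuleCode

/-!
A linear map `f` on a code `C` over `A = M_{m × k}(F)` is determined by its action on rows, so `C`
and `f` may be replaced by the row space `W` of `C` and an `F`-linear map on it. A word is an
`m`-tuple of vectors of `W`, and its `i`-th letter vanishes when the tuple lies in the kernel `K i ≤
W` of the `i`-th coordinate. With `L i` the kernels of the coordinates of `f`, the isometry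
condition says that every `m` vectors of `W` lie in as many of the `L i` as of the `K i`; and `f`
extends to a monomial map exactly when the families `K` and `L` agree up to a permutation, since an
isomorphism between subspaces of `F ^ k` extends to an automorphism.

Both directions rest on one signed family of `∏ j < d, (1 + q ^ j)` subspaces of a space of
dimension `d`. An echelon system chooses, for each `j`, either nothing or a linear form `x j + ∑ l <
j, φ l x l`; its sign is the parity of the number of forms. The signed number of systems vanishing
on a given sequence of vectors factors over `j`, and is zero as soon as the vectors are dependent
(`sum_echelonSign`).

For `m < k`, the `m + 1` columns of an `m × (m + 1)` matrix are dependent, so the even and the odd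
systems of size `m + 1` give two codes of length `N`, with an isometry between them; only the even
ones include the empty system, so it does not extend
(`exists_isHammingIsometry_not_extendsToMonomial`).

Conversely, suppose `K` and `L` do not match. Let `H` be a minimal subspace that lies in different
numbers of `K i` and of `L i`, with difference `a`. Any subspace of dimension at most `m` lies in
equally many, so `dim H > m`. By inversion over the lattice of subspaces, the signed family of all
`K i ⊓ H` and `L i ⊓ H` equals `a` times the family of echelon kernels in `H`. Echelon systems with
the same kernel have the same sign, so these do not cancel, and `2 n ≥ ∏ j < m + 1, (1 + q ^ j) = 2
N`. Moreover, zero is an echelon kernel, so some `K i` or `L i` meets `H` trivially, which gives `k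
≥ dim H > m` (`exists_submodule_of_sum_fiber_ne_zero`, `extendsToMonomial_of_isHammingIsometry`). -/

namespace MatrixModuleCode

/-! ### Inversion over a poset and fibres of finite families -/

section Inversion

open Classical in
/-- Uniqueness in Möbius inversion, stated for a signed family `z` in a poset: if the signed number
of members above `u` is zero for every `u`, then so is the signed number of members equal to `x`. -/
theorem sum_fiber_eq_zero {P ι : Type*} [PartialOrder P] [WellFoundedGT P] [Fintype ι]
    (z : ι → P) (s : ι → ℤ) (h : ∀ u, ∑ i with u ≤ z i, s i = 0) (x : P) :
    ∑ i with z i = x, s i = 0 := by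
  induction x using WellFoundedGT.induction with
  | ind x ih =>
    -- the members strictly above `x` cancel, grouped by their value
    have h1 : ∑ i with x < z i, s i = 0 := by
      rw [← Finset.sum_fiberwise_of_maps_to (t := (Finset.univ.image z).filter (x < ·)) (g := z)
        (by intro i; simp)]
      refine Finset.sum_eq_zero fun y hy => ?_
      have hy' : x < y := (Finset.mem_filter.1 hy).2
      rw [← ih y hy', Finset.filter_filter]
      refine Finset.sum_congr (Finset.filter_congr fun i _ => ?_) fun _ _ => rfl
      exact ⟨fun h => h.2, fun h => ⟨h ▸ hy', h⟩⟩
    rw [← h x, ← add_zero (∑ i with z i = x, s i), ← h1, ← Finset.sum_union]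
    · refine Finset.sum_congr ?_ fun _ _ => rfl
      ext i
      simp [le_iff_eq_or_lt, eq_comm]
    · rw [Finset.disjoint_filter]
      rintro i - rfl
      exact lt_irrefl _

open Classical in
theorem card_le_card_of_fiber_le {P ι κ : Type*} [Fintype ι] [Fintype κ] (z : ι → P) (w : κ → P)
    (h : ∀ x, (Finset.univ.filter fun i => z i = x).card ≤
      (Finset.univ.filter fun i => w i = x).card) :
    Fintype.card ι ≤ Fintype.card κ := by
  rw [← Finset.card_univ, Finset.card_eq_sum_card_image z Finset.univ]
  refine (Finset.sum_le_sum fun x _ => h x).trans ?_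
  simp only [Finset.card_filter]
  rw [Finset.sum_comm, Finset.card_univ.symm, Finset.card_eq_sum_ones]
  refine Finset.sum_le_sum fun i _ => ?_
  rw [Finset.sum_ite_eq]
  split_ifs <;> simp

open Classical in
theorem exists_perm_of_card_fiber_eq {P ι : Type*} [Fintype ι] (z w : ι → P)
    (h : ∀ x, (Finset.univ.filter fun i => z i = x).card =
      (Finset.univ.filter fun i => w i = x).card) :
    ∃ π : Equiv.Perm ι, ∀ i, z i = w (π i) := by
  have e : ∀ x, Nonempty ({i // z i = x} ≃ {i // w i = x}) := fun x =>
    Fintype.card_eq.1 (by simpa [Fintype.card_subtype] using h x)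
  replace e := fun x => (e x).some
  refine ⟨(Equiv.sigmaFiberEquiv z).symm.trans
    ((Equiv.sigmaCongrRight e).trans (Equiv.sigmaFiberEquiv w)), fun i => ?_⟩
  exact (e (z i) ⟨i, rfl⟩).2.symm

end Inversion

/-! ### Signed echelon systems -/

section Echelon

/-- An echelon system of size `d` over `F`: for each position `j`, either `none`, or the
coefficients of a linear form with leading term the `j`-th coordinate in the coordinates before `j`.
There are `∏ j < d, (1 + q ^ j)` of them. -/
abbrev EchelonIndex (F : Type*) (d : ℕ) : Type _ :=
  (j : Fin d) → Option ({l : Fin d // l < j} → F)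

/-- The contribution of one position to the sign: `-1` for a linear form, `1` for `none`. -/
def optionSign {α : Type*} (o : Option α) : ℤ := if o.isSome then -1 else 1

/-- The sign of an echelon system, the parity of the number of its linear forms. -/
def echelonSign {F : Type*} {d : ℕ} (ι : EchelonIndex F d) : ℤ := ∏ j, optionSign (ι j)

theorem echelonSign_eq_or {F : Type*} {d : ℕ} (ι : EchelonIndex F d) :
    echelonSign ι = 1 ∨ echelonSign ι = -1 := by
  refine Finset.prod_induction _ (fun a : ℤ => a = 1 ∨ a = -1) ?_ (Or.inl rfl) ?_
  · rintro a b (rfl | rfl) (rfl | rfl) <;> simp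
  · intro j _
    unfold optionSign
    split_ifs <;> simp

variable {F : Type*} [Field F]

variable {F : Type*} [Field F]

/-- The coefficient vector of the condition that an echelon system imposes at position `j`: zero
for `none`, and `φ` extended by `1` at `j` and by `0` beyond `j` for `some φ`. -/
def echelonRow {d : ℕ} (j : Fin d) : Option ({l : Fin d // l < j} → F) → Fin d → F
  | none => 0
  | some φ => fun l => if h : l < j then φ ⟨l, h⟩ else if l = j then 1 else 0

theorem card_echelonIndex (F : Type*) [Fintype F] (d : ℕ) :
    Fintype.card (EchelonIndex F d) = ∏ j ∈ Finset.range d, (1 + Fintype.card F ^ j) := by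
  rw [Fintype.card_pi, ← Fin.prod_univ_eq_prod_range (fun j => 1 + Fintype.card F ^ j)]
  refine Finset.prod_congr rfl fun j _ => ?_
  rw [Fintype.card_option, Fintype.card_fun, add_comm, Fintype.card_subtype, ← Fin.card_Iio j]
  congr
  ext l
  simp

/-- The factor `1 + q ^ 0 = 2` separates the systems into two halves of `minLength q m` members
each, according to their sign. -/
theorem prod_range_succ_eq_two_mul_minLength (q m : ℕ) :
    ∏ j ∈ Finset.range (m + 1), (1 + q ^ j) = 2 * minLength q m := by
  rw [Finset.prod_range_succ', minLength, Finset.range_eq_Ico,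
    Finset.prod_Ico_add' (fun j => 1 + q ^ j) 0 m 1, mul_comm]
  rfl

variable {V : Type*} [AddCommGroup V] [Module F V] {d : ℕ}

theorem echelonRow_some_self (j : Fin d) (φ : {l : Fin d // l < j} → F) :
    echelonRow j (some φ) j = 1 := by
  simp [echelonRow]

theorem echelonRow_some_of_gt {j l : Fin d} (φ : {l : Fin d // l < j} → F) (h : j < l) :
    echelonRow j (some φ) l = 0 := by
  simp [echelonRow, h.not_gt, h.ne']

theorem sum_echelonRow_some_smul (j : Fin d) (φ : {l : Fin d // l < j} → F) (x : Fin d → V)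
    (hx : ∀ l < j, x l = 0) : ∑ l, echelonRow j (some φ) l • x l = x j := by
  rw [Finset.sum_eq_single j]
  · rw [echelonRow_some_self, one_smul]
  · intro l _ hl
    rcases lt_or_gt_of_ne hl with h | h
    · rw [hx l h, smul_zero]
    · rw [echelonRow_some_of_gt φ h, zero_smul]
  · simp

/-- A nonzero vector, divided by its last nonzero entry, is the row of a linear form. -/
theorem exists_echelonRow_smul_eq (c : Fin d → F) (hc : c ≠ 0) :
    ∃ j, c j ≠ 0 ∧ ∃ φ, echelonRow j (some φ) = (c j)⁻¹ • c := by
  classical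
  obtain ⟨j, hj⟩ := (Set.toFinite {j | c j ≠ 0}).exists_maximal (Function.ne_iff.1 hc)
  have hcj : c j ≠ 0 := hj.1
  refine ⟨j, hcj, fun l => (c j)⁻¹ * c l, funext fun l => ?_⟩
  rcases lt_trichotomy l j with h | rfl | h
  · simp [echelonRow, h]
  · simp [echelonRow, hcj]
  · rw [echelonRow_some_of_gt _ h]
    have : c l = 0 := by
      by_contra h0
      exact (hj.2 h0 h.le).not_gt h
    simp [this]

theorem echelonRow_some_injective (j : Fin d) :
    Function.Injective fun φ : {l : Fin d // l < j} → F => echelonRow j (some φ) := by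
  intro φ ψ h
  funext l
  simpa [echelonRow, l.2] using congrFun h l.1

open Classical in
theorem sum_optionSign [Fintype F] (x : Fin d → V) (j : Fin d) :
    ∑ o : Option ({l : Fin d // l < j} → F),
      (if ∑ l, echelonRow j o l • x l = 0 then optionSign o else 0) =
    1 - ((Finset.univ.filter fun φ : {l : Fin d // l < j} → F =>
        ∑ l, echelonRow j (some φ) l • x l = 0).card : ℤ) := by
  rw [Fintype.sum_option, ← Finset.sum_filter]
  simp [optionSign, echelonRow, sub_eq_add_neg]

open Classical in
/-- The key cancellation. The signed number of echelon systems satisfied by `x` is a product over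
the positions `j` of `1 - #{φ | x j = -∑ l < j, φ l • x l}`. All factors are `1` when `x` is
linearly independent; otherwise the first `x j` in the span of its predecessors is a combination of
them in exactly one way, and its factor vanishes. -/
theorem sum_echelonSign [Fintype F] (x : Fin d → V) :
    ∑ ι : EchelonIndex F d with ∀ j, ∑ l, echelonRow j (ι j) l • x l = 0, echelonSign ι =
      if LinearIndependent F x then 1 else 0 := by
  have hprod : ∑ ι : EchelonIndex F d with ∀ j, ∑ l, echelonRow j (ι j) l • x l = 0,
      echelonSign ι = ∏ j : Fin d, (1 -
        ((Finset.univ.filter fun φ : {l : Fin d // l < j} → F =>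
        ∑ l, echelonRow j (some φ) l • x l = 0).card : ℤ)) := by
    simp_rw [← sum_optionSign]
    rw [Finset.prod_univ_sum, Fintype.piFinset_univ, Finset.sum_filter]
    refine Finset.sum_congr rfl fun ι _ => ?_
    split_ifs with h
    · exact Finset.prod_congr rfl fun j _ => by rw [if_pos (h j)]
    · push Not at h
      obtain ⟨j, hj⟩ := h
      exact (Finset.prod_eq_zero (Finset.mem_univ j) (if_neg hj)).symm
  rw [hprod]
  split_ifs with hx
  · refine Finset.prod_eq_one fun j _ => ?_
    rw [Finset.filter_eq_empty_iff.2, Finset.card_empty, Nat.cast_zero, sub_zero]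
    intro φ _ h
    have := Fintype.linearIndependent_iff.1 hx _ h j
    rw [echelonRow_some_self] at this
    exact one_ne_zero this
  · have hex : ∃ j, ∃ φ : {l : Fin d // l < j} → F,
        ∑ l, echelonRow j (some φ) l • x l = 0 := by
      rw [Fintype.not_linearIndependent_iff] at hx
      obtain ⟨c, hc, i, hi⟩ := hx
      obtain ⟨j, -, φ, hφ⟩ := exists_echelonRow_smul_eq c (Function.ne_iff.2 ⟨i, hi⟩)
      refine ⟨j, φ, ?_⟩
      simp_rw [hφ, Pi.smul_apply, smul_assoc, ← Finset.smul_sum, hc, smul_zero]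
    obtain ⟨j, ⟨φ, hφ⟩, hmin⟩ := WellFounded.has_min (r := ((· < ·) : Fin d → Fin d → Prop))
      wellFounded_lt
      {j | ∃ φ : {l : Fin d // l < j} → F, ∑ l, echelonRow j (some φ) l • x l = 0} hex
    -- two representations of the first dependent vector would give an earlier dependent one
    refine Finset.prod_eq_zero (Finset.mem_univ j) ?_
    rw [sub_eq_zero, eq_comm, Nat.cast_eq_one, Finset.card_eq_one]
    refine ⟨φ, ?_⟩
    ext ψ
    simp only [Finset.mem_filter, Finset.mem_univ, true_and, Finset.mem_singleton]
    refine ⟨fun hψ => ?_, fun h => h ▸ hφ⟩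
    by_contra hne
    have hc : echelonRow j (some ψ) - echelonRow j (some φ) ≠ 0 := fun h =>
      hne (echelonRow_some_injective j (sub_eq_zero.1 h))
    obtain ⟨i, hi, χ, hχ⟩ := exists_echelonRow_smul_eq _ hc
    refine hmin i ⟨χ, ?_⟩ ?_
    · simp_rw [hχ, Pi.smul_apply, smul_assoc, ← Finset.smul_sum, Pi.sub_apply, sub_smul,
        Finset.sum_sub_distrib, hφ, hψ, sub_zero, smul_zero]
    · by_contra hij
      refine hi ?_
      rcases (not_lt.1 hij).eq_or_lt with rfl | h
      · simp [echelonRow_some_self]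
      · simp [echelonRow_some_of_gt _ h]

end Echelon

/-! ### Kernels of echelon systems as a signed family of subspaces -/

section Kernels

variable {F H : Type*} [Field F] [AddCommGroup H] [Module F H] {d : ℕ}

/-- The subspace of `H` cut out by the conditions of an echelon system in the coordinates of `b`. -/
noncomputable def echelonKernel (b : Module.Basis (Fin d) F H) (ι : EchelonIndex F d) :
    Submodule F H :=
  ⨅ j, LinearMap.ker (∑ l, echelonRow j (ι j) l • b.coord l)

theorem mem_echelonKernel (b : Module.Basis (Fin d) F H) (ι : EchelonIndex F d) (y : H) :
    y ∈ echelonKernel b ι ↔ ∀ j, ∑ l, echelonRow j (ι j) l • b.coord l y = 0 := by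
  simp [echelonKernel]

theorem linearIndependent_coord_domRestrict_iff (b : Module.Basis (Fin d) F H)
    (U : Submodule F H) :
    LinearIndependent F (fun l => (b.coord l).domRestrict U) ↔ U = ⊤ := by
  constructor
  · intro h
    by_contra hU
    obtain ⟨f, hf, hUf⟩ := Submodule.exists_le_ker_of_lt_top U (lt_top_iff_ne_top.2 hU)
    refine hf (b.ext fun l => ?_)
    refine Fintype.linearIndependent_iff.1 h (fun l => f (b l)) ?_ l
    ext u
    have h0 : f (u : H) = 0 := hUf u.2
    rw [← b.sum_repr u, map_sum] at h0
    simpa [mul_comm] using h0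
  · rintro rfl
    refine Fintype.linearIndependent_iff.2 fun g hg i => ?_
    simpa [Finsupp.single_apply] using LinearMap.congr_fun hg ⟨b i, trivial⟩

open Classical in
/-- The signed family of echelon kernels has Möbius-type cancellation: the members containing `U`
cancel unless `U` is the whole space. It realises the Möbius function of the subspace lattice. -/
theorem sum_echelonSign_le_echelonKernel [Fintype F] (b : Module.Basis (Fin d) F H)
    (U : Submodule F H) :
    ∑ ι : EchelonIndex F d with U ≤ echelonKernel b ι, echelonSign ι = if U = ⊤ then 1 else 0 := by
  rw [← if_congr (linearIndependent_coord_domRestrict_iff b U) rfl rfl, ← sum_echelonSign]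
  refine Finset.sum_congr (Finset.filter_congr fun ι _ => ?_) fun _ _ => rfl
  simp only [SetLike.le_def, mem_echelonKernel, LinearMap.ext_iff]
  constructor
  · intro h j u
    simpa using h u.2 j
  · intro h u hu j
    simpa using h j ⟨u, hu⟩

/-- The positions that carry a linear form can be read off the kernel: they are those `j` for which
the `j`-th coordinate, restricted to the kernel, depends on the preceding ones. -/
theorem isSome_iff_of_echelonKernel (b : Module.Basis (Fin d) F H) (ι : EchelonIndex F d)
    (j : Fin d) : (ι j).isSome ↔ ∃ φ : {l : Fin d // l < j} → F,
      ∀ y ∈ echelonKernel b ι, ∑ l, echelonRow j (some φ) l • b.coord l y = 0 := by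
  constructor
  · intro h
    obtain ⟨φ, hφ⟩ := Option.isSome_iff_exists.1 h
    exact ⟨φ, fun y hy => hφ ▸ (mem_echelonKernel b ι y).1 hy j⟩
  · rintro ⟨φ, hφ⟩
    by_contra hj
    -- the unitriangular system obtained by adding the form `x i` wherever there is none; solving
    -- `T v = e j` gives a vector of the kernel with leading coordinate `j`
    let T : (Fin d → F) →ₗ[F] (Fin d → F) :=
      Matrix.mulVecLin (Matrix.of fun i => echelonRow i (some ((ι i).getD 0)))
    have hT : ∀ v i, T v i = ∑ l, echelonRow i (some ((ι i).getD 0)) l • v l := fun v i => rfl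
    have hlow : ∀ v : Fin d → F, ∀ i, (∀ l < i, T v l = 0) → ∀ l < i, v l = 0 := by
      intro v i hv l
      induction l using WellFoundedLT.induction with
      | ind l ih =>
        intro hl
        rw [← hv l hl, hT, sum_echelonRow_some_smul _ _ _ fun p hp => ih p hp (hp.trans hl)]
    have hinj : Function.Injective T := by
      rw [← LinearMap.ker_eq_bot, LinearMap.ker_eq_bot']
      intro v hv
      funext i
      have := hlow v i fun l _ => congrFun hv l
      rw [← sum_echelonRow_some_smul i ((ι i).getD 0) v this, ← hT, hv]
    obtain ⟨v, hv⟩ := (LinearMap.injective_iff_surjective.1 hinj) (Pi.single j 1)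
    have h0 : ∀ l < j, v l = 0 := hlow v j fun l hl => by rw [hv, Pi.single_eq_of_ne hl.ne]
    have h1 : v j = 1 := by
      rw [← sum_echelonRow_some_smul j ((ι j).getD 0) v h0, ← hT, hv, Pi.single_eq_same]
    have hcoord : ∀ l, b.coord l (b.equivFun.symm v) = v l := fun l => by
      rw [Module.Basis.coord_apply, ← b.equivFun_apply, LinearEquiv.apply_symm_apply]
    have hmem : b.equivFun.symm v ∈ echelonKernel b ι := by
      refine (mem_echelonKernel b ι _).2 fun i => ?_
      simp_rw [hcoord]
      cases hi : ι i with
      | none => simp [echelonRow]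
      | some ψ =>
        have hij : i ≠ j := by
          rintro rfl
          exact hj (by rw [hi]; rfl)
        have := hT v i
        rw [hv, Pi.single_eq_of_ne hij, hi] at this
        exact this.symm
    have := hφ _ hmem
    simp_rw [hcoord] at this
    rw [sum_echelonRow_some_smul j φ v h0, h1] at this
    exact one_ne_zero this

/-- Systems with the same kernel have the same sign, so no cancellation occurs among them. -/
theorem echelonSign_eq_of_echelonKernel_eq (b : Module.Basis (Fin d) F H)
    {ι ι' : EchelonIndex F d} (h : echelonKernel b ι = echelonKernel b ι') :
    echelonSign ι = echelonSign ι' := by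
  refine Finset.prod_congr rfl fun j _ => ?_
  unfold optionSign
  refine if_congr ?_ rfl rfl
  rw [isSome_iff_of_echelonKernel b, isSome_iff_of_echelonKernel b, h]

open Classical in
theorem abs_sum_echelonSign_fiber [Fintype F] (b : Module.Basis (Fin d) F H) (Y : Submodule F H) :
    |∑ ι : EchelonIndex F d with echelonKernel b ι = Y, echelonSign ι| =
      (Finset.univ.filter fun ι : EchelonIndex F d => echelonKernel b ι = Y).card := by
  by_cases hY : ∃ ι, echelonKernel b ι = Y
  · obtain ⟨ι, rfl⟩ := hY
    rw [Finset.sum_congr rfl fun κ hκ => echelonSign_eq_of_echelonKernel_eq b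
      (Finset.mem_filter.1 hκ).2, Finset.sum_const, nsmul_eq_mul, abs_mul]
    rcases echelonSign_eq_or ι with h | h <;> simp [h]
  · push Not at hY
    simp [hY]

theorem echelonKernel_some_zero (b : Module.Basis (Fin d) F H) :
    echelonKernel b (fun _ => some 0) = ⊥ := by
  rw [eq_bot_iff]
  intro y hy
  rw [mem_echelonKernel] at hy
  have h : ∀ j, b.coord j y = 0 := by
    intro j
    rw [← hy j, Finset.sum_eq_single j]
    · simp [echelonRow_some_self]
    · intro l _ hl
      rcases lt_or_gt_of_ne hl with h | h
      · simp [echelonRow, h]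
      · simp [echelonRow_some_of_gt _ h]
    · simp
  exact b.ext_elem (by simpa using h)

end Kernels

/-! ### The lower bound for balanced families of subspaces -/

section LowerBound

theorem sum_filter_sum_type {α β M : Type*} [Fintype α] [Fintype β] [AddCommMonoid M]
    (p : α ⊕ β → Prop) [DecidablePred p] (f : α ⊕ β → M) :
    ∑ i with p i, f i = ∑ i with p (Sum.inl i), f (Sum.inl i) +
      ∑ i with p (Sum.inr i), f (Sum.inr i) := by
  simp only [Finset.sum_filter, Fintype.sum_sum_type]

open Classical in
/-- Let `X` be a family of subspaces with signs, in which the members containing any given `m`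
vectors cancel, but the members equal to some `Y` do not. Then there are a subspace `H` of dimension
greater than `m` that some member meets trivially, and at least `∏ j < dim H, (1 + q ^ j)` members.

`H` is a minimal subspace contained in a nonzero signed number `a` of members. The family of the
intersections with `H` is then `a` times the signed family of echelon kernels in `H`. -/
theorem exists_submodule_of_sum_fiber_ne_zero {F W κ : Type*} [Field F] [Fintype F]
    [AddCommGroup W] [Module F W] [FiniteDimensional F W] [Fintype κ] {m : ℕ}
    (X : κ → Submodule F W) (s : κ → ℤ) (hs : ∀ i, |s i| ≤ 1)
    (h : ∀ w : Fin m → W, ∑ i with ∀ r, w r ∈ X i, s i = 0)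
    (Y : Submodule F W) (hY : ∑ i with X i = Y, s i ≠ 0) :
    ∃ H : Submodule F W, m < Module.finrank F H ∧ (∃ i, Disjoint (X i) H) ∧
      ∏ j ∈ Finset.range (Module.finrank F H), (1 + Fintype.card F ^ j) ≤ Fintype.card κ := by
  have hex : ∃ U, ∑ i with U ≤ X i, s i ≠ 0 := by
    by_contra! hno
    exact hY (sum_fiber_eq_zero X s hno Y)
  obtain ⟨H, hH, hmin⟩ := WellFounded.has_min
    (r := ((· < ·) : Submodule F W → Submodule F W → Prop)) wellFounded_lt
    {U | ∑ i with U ≤ X i, s i ≠ 0} hex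
  set a : ℤ := ∑ i with H ≤ X i, s i with ha
  have hmin' : ∀ U < H, ∑ i with U ≤ X i, s i = 0 := fun U hU => by
    by_contra hne
    exact hmin U hne hU
  set d := Module.finrank F H with hd
  let b : Module.Basis (Fin d) F H := Module.finBasis F H
  -- a space of dimension at most `m` is spanned by `m` vectors, padded by zeros
  have hmd : m < d := by
    by_contra! hle
    refine hH ?_
    refine (Finset.sum_congr (Finset.filter_congr fun i _ => ?_) fun _ _ => rfl).trans
      (h fun r => if hr : (r : ℕ) < d then (b ⟨r, hr⟩ : W) else 0)
    constructor
    · intro hi r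
      split_ifs
      · exact hi (b _).2
      · exact zero_mem _
    · intro hi
      have : Submodule.comap H.subtype (X i) = ⊤ := by
        rw [eq_top_iff, ← b.span_eq, Submodule.span_le]
        rintro _ ⟨l, rfl⟩
        simpa using hi (Fin.castLE hle l)
      rwa [Submodule.comap_subtype_eq_top] at this
  -- the intersections with `H` and `a` times the echelon kernels agree, by inversion
  have hfib : ∀ y : Submodule F H,
      ∑ i with (X i).comap H.subtype = y, s i =
        a * ∑ ι : EchelonIndex F d with echelonKernel b ι = y, echelonSign ι := by
    intro y
    have key := sum_fiber_eq_zero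
      (Sum.elim (fun i => (X i).comap H.subtype) (echelonKernel b))
      (Sum.elim s fun ι => -(a * echelonSign ι)) ?_ y
    · rw [sum_filter_sum_type] at key
      change ∑ i with (X i).comap H.subtype = y, s i +
        ∑ ι with echelonKernel b ι = y, -(a * echelonSign ι) = 0 at key
      rw [Finset.sum_neg_distrib, ← Finset.mul_sum] at key
      linarith
    · intro U
      rw [sum_filter_sum_type]
      change ∑ i with U ≤ (X i).comap H.subtype, s i +
        ∑ ι with U ≤ echelonKernel b ι, -(a * echelonSign ι) = 0
      rw [Finset.sum_neg_distrib, ← Finset.mul_sum, sum_echelonSign_le_echelonKernel]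
      have hU : ∑ i with U ≤ (X i).comap H.subtype, s i =
          ∑ i with U.map H.subtype ≤ X i, s i := by
        refine Finset.sum_congr (Finset.filter_congr fun i _ => ?_) fun _ _ => rfl
        rw [Submodule.map_le_iff_le_comap]
      rw [hU]
      split_ifs with htop
      · rw [htop, Submodule.map_subtype_top, ← ha]
        ring
      · rw [hmin']
        · ring
        · refine lt_of_le_of_ne (Submodule.map_subtype_le _ _) fun heq => htop ?_
          exact Submodule.map_injective_of_injective H.injective_subtype
            (heq.trans (Submodule.map_subtype_top H).symm)
  -- echelon kernels equal to `y` all have one sign, and `|a| ≥ 1`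
  have hfib' : ∀ y : Submodule F H,
      (Finset.univ.filter fun ι : EchelonIndex F d => echelonKernel b ι = y).card ≤
        (Finset.univ.filter fun i => (X i).comap H.subtype = y).card := by
    intro y
    have h1 : (1 : ℤ) ≤ |a| := Int.one_le_abs hH
    have h2 := abs_sum_echelonSign_fiber b y
    have h3 := congrArg abs (hfib y)
    rw [abs_mul, h2] at h3
    have h4 : |∑ i with (X i).comap H.subtype = y, s i| ≤
        ((Finset.univ.filter fun i => (X i).comap H.subtype = y).card : ℤ) := by
      refine (Finset.abs_sum_le_sum_abs _ _).trans ((Finset.sum_le_sum fun i _ => hs i).trans ?_)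
      simp
    zify
    nlinarith
  refine ⟨H, hmd, ?_, ?_⟩
  · have hpos := (Finset.card_pos.2 ⟨fun _ => some 0, Finset.mem_filter.2
      ⟨Finset.mem_univ _, echelonKernel_some_zero b⟩⟩).trans_le (hfib' ⊥)
    obtain ⟨i, hi⟩ := Finset.card_pos.1 hpos
    refine ⟨i, ?_⟩
    rw [disjoint_comm]
    exact Submodule.disjoint_iff_comap_eq_bot.2 (Finset.mem_filter.1 hi).2
  · rw [← card_echelonIndex]
    exact card_le_card_of_fiber_le _ _ hfib'

end LowerBound

/-! ### Hamming isometries in terms of zero coordinates -/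

section Isometry

open Classical in
theorem isHammingIsometry_iff {R A : Type*} [Ring R] [AddCommGroup A] [Module R A] {n : ℕ}
    {C : Submodule R (Fin n → A)} (f : C →ₗ[R] (Fin n → A)) :
    IsHammingIsometry f ↔ ∀ x : C, (Finset.univ.filter fun i => f x i = 0).card =
      (Finset.univ.filter fun i => (x : Fin n → A) i = 0).card := by
  have hdist : ∀ x y : Fin n → A,
      hammingDist x y + (Finset.univ.filter fun i => (x - y) i = 0).card = n := by
    intro x y
    have := Finset.card_filter_add_card_filter_not (s := Finset.univ) fun i => x i ≠ y i
    simpa [hammingDist, sub_eq_zero] using this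
  constructor
  · intro h x
    have h1 := h x 0
    have h2 := hdist (f x) (f 0)
    have h3 := hdist x (0 : C)
    simp only [map_zero, sub_zero, ZeroMemClass.coe_zero] at h1 h2 h3
    omega
  · intro h x y
    have h1 := h (x - y)
    have h2 := hdist (f x) (f y)
    have h3 := hdist x y
    rw [map_sub, Submodule.coe_sub] at h1
    omega

end Isometry

/-! ### An unextendable isometry -/

section Counterexample

variable {F : Type*} [Field F] {m k : ℕ}

/-- The `d × k` matrix whose first `d` columns are the rows of an echelon system and whose other
columns are zero. For `k < d` the system is truncated; it is used with `d ≤ k` only. -/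
def echelonMatrix (k : ℕ) {d : ℕ} (ι : EchelonIndex F d) : Matrix (Fin d) (Fin k) F :=
  Matrix.of fun l t => if h : (t : ℕ) < d then echelonRow ⟨t, h⟩ (ι ⟨t, h⟩) l else 0

theorem mul_echelonMatrix_eq_zero_iff {d : ℕ} (hd : d ≤ k) (c : Matrix (Fin m) (Fin d) F)
    (ι : EchelonIndex F d) :
    c * echelonMatrix k ι = 0 ↔ ∀ j, ∑ l, echelonRow j (ι j) l • c.col l = 0 := by
  constructor
  · intro h j
    funext r
    have := congrFun (congrFun h r) (Fin.castLE hd j)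
    simpa [Matrix.mul_apply, echelonMatrix, mul_comm] using this
  · intro h
    ext r t
    by_cases ht : (t : ℕ) < d
    · have := congrFun (h ⟨t, ht⟩) r
      simpa [Matrix.mul_apply, echelonMatrix, mul_comm, ht] using this
    · simp [Matrix.mul_apply, echelonMatrix, ht]

/-- Encoding of `m × d` matrices by a list of echelon systems: the `i`-th letter of the codeword of
`c` is the product of `c` with the matrix of the `i`-th system. -/
def echelonEncode (m k : ℕ) {d n : ℕ} (e : Fin n → EchelonIndex F d) :
    Matrix (Fin m) (Fin d) F →ₗ[Matrix (Fin m) (Fin m) F] (Fin n → Matrix (Fin m) (Fin k) F) where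
  toFun c i := c * echelonMatrix k (e i)
  map_add' _ _ := funext fun _ => Matrix.add_mul _ _ _
  map_smul' _ _ := funext fun _ => Matrix.mul_assoc _ _ _

open Classical in
/-- The `m + 1` columns of `c` lie in a space of dimension `m`, so they are dependent. -/
theorem sum_echelonSign_mul_echelonMatrix [Fintype F] (hk : m < k)
    (c : Matrix (Fin m) (Fin (m + 1)) F) :
    ∑ ι : EchelonIndex F (m + 1) with c * echelonMatrix k ι = 0, echelonSign ι = 0 := by
  have hli : ¬ LinearIndependent F c.col := by
    intro hli
    have := hli.fintype_card_le_finrank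
    simp at this
  have h := sum_echelonSign (F := F) c.col
  rw [if_neg hli] at h
  rw [← h]
  refine Finset.sum_congr ?_ fun _ _ => rfl
  ext ι
  simp only [Finset.mem_filter, Finset.mem_univ, true_and]
  exact mul_echelonMatrix_eq_zero_iff (Nat.succ_le_of_lt hk) c ι

theorem card_filter_echelonSign_eq {F : Type*} [Fintype F] (p : EchelonIndex F (m + 1) → Prop)
    [DecidablePred p]     (h : ∑ ι with p ι, echelonSign ι = 0) :
    (Finset.univ.filter fun ι => p ι ∧ echelonSign ι = 1).card =
      (Finset.univ.filter fun ι => p ι ∧ echelonSign ι = -1).card := by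
  have h1 : ∀ ι : EchelonIndex F (m + 1), echelonSign ι =
      (if echelonSign ι = 1 then 1 else 0) - (if echelonSign ι = -1 then 1 else 0) := by
    intro ι
    rcases echelonSign_eq_or ι with h | h <;> simp [h]
  rw [Finset.sum_congr rfl fun ι _ => h1 ι, Finset.sum_sub_distrib, Finset.sum_boole,
    Finset.sum_boole, Finset.filter_filter, Finset.filter_filter, sub_eq_zero] at h
  exact_mod_cast h

open Classical in
/-- Even and odd systems are equinumerous, by the cancellation for `c = 0`. -/
theorem card_echelonSign [Fintype F] (m : ℕ) (ε : ℤ) (hε : ε = 1 ∨ ε = -1) :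
    Fintype.card {ι : EchelonIndex F (m + 1) // echelonSign ι = ε} =
      minLength (Fintype.card F) m := by
  have h0 := sum_echelonSign_mul_echelonMatrix (F := F) (Nat.lt_succ_self m) 0
  have h1 := card_filter_echelonSign_eq (F := F) (m := m) (fun _ => True) (by simpa using h0)
  have h2 : Fintype.card (EchelonIndex F (m + 1)) = _ := card_echelonIndex F (m + 1)
  rw [prod_range_succ_eq_two_mul_minLength, ← Finset.card_univ,
    ← Finset.card_filter_add_card_filter_not (fun ι => echelonSign ι = 1)] at h2
  have h3 : (Finset.univ.filter fun ι : EchelonIndex F (m + 1) => ¬ echelonSign ι = 1) =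
      Finset.univ.filter fun ι => echelonSign ι = -1 := by
    refine Finset.filter_congr fun ι _ => ?_
    rcases echelonSign_eq_or ι with h | h <;> simp [h]
  rw [h3] at h2
  simp only [true_and] at h1
  rcases hε with rfl | rfl <;> rw [Fintype.card_subtype] <;> omega

open Classical in
theorem card_filter_echelonEncode_eq_zero [Fintype F] {d n : ℕ} {ε : ℤ}
    (e : Fin n ≃ {ι : EchelonIndex F d // echelonSign ι = ε}) (c : Matrix (Fin m) (Fin d) F) :
    (Finset.univ.filter fun i =>
      echelonEncode m k (fun i => (e i : EchelonIndex F d)) c i = 0).card =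
    (Finset.univ.filter fun ι : EchelonIndex F d =>
      c * echelonMatrix k ι = 0 ∧ echelonSign ι = ε).card := by
  refine Finset.card_bij (fun i _ => (e i : EchelonIndex F d)) ?_ ?_ ?_
  · intro i hi
    have := (Finset.mem_filter.1 hi).2
    refine Finset.mem_filter.2 ⟨Finset.mem_univ _, ?_, (e i).2⟩
    exact this
  · intro i _ j _ hij
    exact e.injective (Subtype.ext hij)
  · intro ι hι
    obtain ⟨h2, h3⟩ := (Finset.mem_filter.1 hι).2
    refine ⟨e.symm ⟨ι, h3⟩, ?_, by simp⟩
    refine Finset.mem_filter.2 ⟨Finset.mem_univ _, ?_⟩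
    change c * echelonMatrix k (e _ : EchelonIndex F d) = 0
    rw [Equiv.apply_symm_apply]
    exact h2

/-- Encoding by the even and by the odd systems of size `m + 1` gives words with equally many zero
letters, hence an isometry between the two codes. It is not monomial, because the empty system
encodes everything by zero and is even, while every odd system is nonempty. -/
theorem exists_isHammingIsometry_not_extendsToMonomial [Fintype F] (hm : 0 < m) (hk : m < k) :
    ∃ (C : Submodule (Matrix (Fin m) (Fin m) F)
        (Fin (minLength (Fintype.card F) m) → Matrix (Fin m) (Fin k) F))
      (f : C →ₗ[Matrix (Fin m) (Fin m) F]
        (Fin (minLength (Fintype.card F) m) → Matrix (Fin m) (Fin k) F)),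
      IsHammingIsometry f ∧ ¬ ExtendsToMonomial f := by
  classical
  have hcard := card_echelonSign (F := F) m
  generalize minLength (Fintype.card F) m = N at hcard ⊢
  obtain e₀ := (Fintype.equivFinOfCardEq (hcard 1 (Or.inl rfl))).symm
  obtain e₁ := (Fintype.equivFinOfCardEq (hcard (-1) (Or.inr rfl))).symm
  let Φ₀ := echelonEncode m k fun i => (e₀ i : EchelonIndex F (m + 1))
  let Φ₁ := echelonEncode m k fun i => (e₁ i : EchelonIndex F (m + 1))
  have hzeros : ∀ c, (Finset.univ.filter fun i => Φ₁ c i = 0).card =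
      (Finset.univ.filter fun i => Φ₀ c i = 0).card := by
    intro c
    have h0 : (Finset.univ.filter fun i => Φ₀ c i = 0).card = _ :=
      card_filter_echelonEncode_eq_zero (k := k) e₀ c
    have h1 : (Finset.univ.filter fun i => Φ₁ c i = 0).card = _ :=
      card_filter_echelonEncode_eq_zero (k := k) e₁ c
    rw [h0, h1]
    exact (card_filter_echelonSign_eq (fun ι => c * echelonMatrix k ι = 0)
      (sum_echelonSign_mul_echelonMatrix hk c)).symm
  have hker : LinearMap.ker Φ₀ ≤ LinearMap.ker Φ₁ := by
    intro c hc
    rw [LinearMap.mem_ker] at hc ⊢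
    have := hzeros c
    rw [Finset.filter_true_of_mem (p := fun i => Φ₀ c i = 0) fun i _ => congrFun hc i,
      Finset.card_filter_eq_iff] at this
    exact funext fun i => this i (Finset.mem_univ i)
  let f := ((LinearMap.ker Φ₀).liftQ Φ₁ hker).comp Φ₀.quotKerEquivRange.symm.toLinearMap
  have hf : ∀ c, f ⟨Φ₀ c, LinearMap.mem_range_self _ c⟩ = Φ₁ c := by
    intro c
    change (LinearMap.ker Φ₀).liftQ Φ₁ hker (Φ₀.quotKerEquivRange.symm ⟨Φ₀ c, _⟩) = _
    rw [LinearMap.quotKerEquivRange_symm_apply_image, Submodule.mkQ_apply, Submodule.liftQ_apply]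
  refine ⟨LinearMap.range Φ₀, f, ?_, ?_⟩
  · rw [isHammingIsometry_iff]
    rintro ⟨_, c, rfl⟩
    rw [hf]
    convert hzeros c
  · rintro ⟨h, ⟨π, g, hg⟩, hh⟩
    have hsign : echelonSign (fun _ => none : EchelonIndex F (m + 1)) = 1 := by
      simp [echelonSign, optionSign]
    obtain ⟨i₀, hi₀⟩ := e₀.surjective ⟨fun _ => none, hsign⟩
    obtain ⟨j, rfl⟩ := π.surjective i₀
    have hzero : ∀ c, Φ₁ c j = 0 := by
      intro c
      rw [← hf, ← hh ⟨Φ₀ c, _⟩, hg]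
      have : Φ₀ c (π j) = 0 := by
        change c * echelonMatrix k (e₀ (π j) : EchelonIndex F (m + 1)) = 0
        rw [hi₀, mul_echelonMatrix_eq_zero_iff (Nat.succ_le_of_lt hk)]
        simp [echelonRow]
      exact (congrArg (g j) this).trans (map_zero _)
    -- an odd system has a linear form, and does not vanish on the matrix unit at its position
    have hsome : ∃ t φ, (e₁ j : EchelonIndex F (m + 1)) t = some φ := by
      by_contra! hno
      have hnone : (e₁ j : EchelonIndex F (m + 1)) = fun _ => none :=
        funext fun t => Option.eq_none_iff_forall_ne_some.2 (hno t)
      have := (e₁ j).2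
      rw [hnone, hsign] at this
      norm_num at this
    obtain ⟨t, φ, hφ⟩ := hsome
    have hc := (mul_echelonMatrix_eq_zero_iff (Nat.succ_le_of_lt hk) _ _).1
      (hzero (Matrix.single ⟨0, hm⟩ t 1)) t
    change ∑ l, echelonRow t ((e₁ j : EchelonIndex F (m + 1)) t) l • _ = _ at hc
    rw [hφ] at hc
    have hc0 := congrFun hc ⟨0, hm⟩
    rw [Finset.sum_apply, Finset.sum_eq_single t] at hc0
    · simp [echelonRow_some_self] at hc0
    · intro l _ hl
      simp [Matrix.single, hl.symm]
    · simp

end Counterexample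

/-! ### Codes over matrix modules and their row spaces -/

section Rows

variable {F : Type*} [Field F] {m k n : ℕ}

theorem matrix_smul_apply (T : Matrix (Fin m) (Fin m) F) (c : Fin n → Matrix (Fin m) (Fin k) F)
    (i : Fin n) : (T • c) i = T * c i := rfl

/-- The word of matrices with `r`-th rows `w` and all other rows zero. -/
def rowEmbed (r : Fin m) (w : Fin n → Fin k → F) : Fin n → Matrix (Fin m) (Fin k) F :=
  fun i => Matrix.of fun s => if s = r then w i else 0

@[simp]
theorem rowEmbed_apply_self (r : Fin m) (w : Fin n → Fin k → F) (i : Fin n) :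
    rowEmbed r w i r = w i :=
  if_pos rfl

theorem rowEmbed_add (r : Fin m) (w w' : Fin n → Fin k → F) :
    rowEmbed r (w + w') = rowEmbed r w + rowEmbed r w' := by
  ext i s t
  by_cases h : s = r <;> simp [rowEmbed, h]

theorem rowEmbed_zero (r : Fin m) : rowEmbed r (0 : Fin n → Fin k → F) = 0 := by
  ext i s t
  simp [rowEmbed]

theorem single_smul_eq_rowEmbed (s r : Fin m) (a : F) (c : Fin n → Matrix (Fin m) (Fin k) F) :
    Matrix.single s r a • c = rowEmbed s (a • fun i => c i r) := by
  ext i p t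
  rw [matrix_smul_apply]
  by_cases h : p = s
  · subst h
    simp [rowEmbed]
  · simp [rowEmbed, h]

theorem single_smul_rowEmbed (s r : Fin m) (a : F) (w : Fin n → Fin k → F) :
    Matrix.single s r a • rowEmbed r w = rowEmbed s (a • w) := by
  rw [single_smul_eq_rowEmbed]
  simp only [rowEmbed_apply_self]

variable (C : Submodule (Matrix (Fin m) (Fin m) F) (Fin n → Matrix (Fin m) (Fin k) F))

/-- The row space of the code `C`: the `F`-space of all `w` such that the word with `r`-th rows `w`
and other rows zero lies in `C`. It does not depend on `r`, and `C` consists of the words all of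
whose rows lie in it. -/
def rowCode (r : Fin m) : Submodule F (Fin n → Fin k → F) where
  carrier := {w | rowEmbed r w ∈ C}
  add_mem' {w w'} hw hw' := by
    rw [Set.mem_ofPred, rowEmbed_add]
    exact C.add_mem hw hw'
  zero_mem' := by
    rw [Set.mem_ofPred, rowEmbed_zero]
    exact C.zero_mem
  smul_mem' a w hw := by
    rw [Set.mem_ofPred, ← single_smul_rowEmbed r r]
    exact C.smul_mem _ hw

variable {C}

theorem row_mem_rowCode {c : Fin n → Matrix (Fin m) (Fin k) F} (hc : c ∈ C) (r₀ r : Fin m) :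
    (fun i => c i r) ∈ rowCode C r₀ := by
  change rowEmbed r₀ _ ∈ C
  rw [← one_smul F fun i => c i r, ← single_smul_eq_rowEmbed]
  exact C.smul_mem _ hc

theorem of_rows_mem (r₀ : Fin m) (w : Fin m → rowCode C r₀) :
    (fun i => Matrix.of fun r => (w r : Fin n → Fin k → F) i) ∈ C := by
  have h : (fun i => Matrix.of fun r => (w r : Fin n → Fin k → F) i) =
      ∑ r, Matrix.single r r₀ (1 : F) • rowEmbed r₀ (w r : Fin n → Fin k → F) := by
    ext i s t
    simp_rw [single_smul_rowEmbed, one_smul]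
    simp [rowEmbed, Finset.sum_apply, Matrix.sum_apply, ite_apply]
  rw [h]
  exact C.sum_mem fun r _ => C.smul_mem _ (w r).2

/-- The `F`-linear map induced by `f` on the row space; `f` acts by it on every row. -/
def rowMap (r : Fin m)
    (f : C →ₗ[Matrix (Fin m) (Fin m) F] (Fin n → Matrix (Fin m) (Fin k) F)) :
    rowCode C r →ₗ[F] (Fin n → Fin k → F) where
  toFun w i := f ⟨rowEmbed r w, w.2⟩ i r
  map_add' w w' := by
    have h : (⟨rowEmbed r (w + w' : rowCode C r), (w + w').2⟩ : C) =
        ⟨rowEmbed r w, w.2⟩ + ⟨rowEmbed r w', w'.2⟩ := Subtype.ext (rowEmbed_add r w.1 w'.1)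
    rw [h, map_add]
    rfl
  map_smul' a w := by
    have h : (⟨rowEmbed r (a • w : rowCode C r), (a • w).2⟩ : C) =
        Matrix.single r r a • ⟨rowEmbed r w, w.2⟩ :=
      Subtype.ext (single_smul_rowEmbed r r a w.1).symm
    rw [h, map_smul, single_smul_eq_rowEmbed]
    funext i
    simp only [rowEmbed_apply_self]
    rfl

theorem rowMap_row (r₀ r : Fin m)
    (f : C →ₗ[Matrix (Fin m) (Fin m) F] (Fin n → Matrix (Fin m) (Fin k) F)) (c : C) (i : Fin n) :
    rowMap r₀ f ⟨fun i => (c : Fin n → Matrix (Fin m) (Fin k) F) i r, row_mem_rowCode c.2 r₀ r⟩ i =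
      f c i r := by
  have h : (⟨rowEmbed r₀ fun i => (c : Fin n → Matrix (Fin m) (Fin k) F) i r,
      row_mem_rowCode c.2 r₀ r⟩ : C) = Matrix.single r₀ r (1 : F) • c := by
    refine Subtype.ext ?_
    rw [Submodule.coe_smul, single_smul_eq_rowEmbed, one_smul]
  change f ⟨rowEmbed r₀ fun i => (c : Fin n → Matrix (Fin m) (Fin k) F) i r, _⟩ i r₀ = _
  rw [h, map_smul, single_smul_eq_rowEmbed, one_smul, rowEmbed_apply_self]

/-- An automorphism `g` of `F ^ k`, applied to each row of a matrix; such maps are left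
`Matrix (Fin m) (Fin m) F`-linear. -/
def rowwiseEquiv (m : ℕ) (g : (Fin k → F) ≃ₗ[F] (Fin k → F)) :
    Matrix (Fin m) (Fin k) F ≃ₗ[Matrix (Fin m) (Fin m) F] Matrix (Fin m) (Fin k) F where
  toFun a := Matrix.of fun r => g (a r)
  invFun a := Matrix.of fun r => g.symm (a r)
  left_inv a := funext fun r => g.symm_apply_apply (a r)
  right_inv a := funext fun r => g.apply_symm_apply (a r)
  map_add' a a' := funext fun r => map_add g (a r) (a' r)
  map_smul' T a := by
    funext r
    change g ((T * a) r) = (T * Matrix.of fun r => g (a r)) r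
    have h : ∀ a : Matrix (Fin m) (Fin k) F, (T * a) r = ∑ s, T r s • a s := by
      intro a
      funext t
      simp [Matrix.mul_apply]
    rw [h, h, map_sum]
    simp_rw [map_smul]
    rfl

end Rows

/-! ### Extension of isometries -/

section Extension

theorem finrank_le_of_disjoint_ker {F V W : Type*} [Field F] [AddCommGroup V] [Module F V]
    [FiniteDimensional F V] [AddCommGroup W] [Module F W] (f : W →ₗ[F] V) (H : Submodule F W)
    (h : Disjoint (LinearMap.ker f) H) : Module.finrank F H ≤ Module.finrank F V :=
  LinearMap.finrank_le_finrank_of_injective (f := f.domRestrict H)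
    (LinearMap.injective_domRestrict_iff.2 h.symm)

theorem exists_linearEquiv_comp_eq_of_ker_eq {F V W : Type*} [Field F] [AddCommGroup V]
    [Module F V] [FiniteDimensional F V] [AddCommGroup W] [Module F W] (f g : W →ₗ[F] V)
    (h : LinearMap.ker f = LinearMap.ker g) : ∃ e : V ≃ₗ[F] V, ∀ w, f w = e (g w) := by
  obtain ⟨e, he⟩ := Submodule.exists_linearEquiv_restrict_eq
    (g.quotKerEquivRange.symm ≪≫ₗ Submodule.quotEquivOfEq _ _ h.symm ≪≫ₗ f.quotKerEquivRange)
  refine ⟨e, fun w => ?_⟩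
  rw [← he ⟨g w, LinearMap.mem_range_self g w⟩]
  simp [LinearMap.quotKerEquivRange_symm_apply_image]

variable {F : Type*} [Field F] {m k n : ℕ}
  {C : Submodule (Matrix (Fin m) (Fin m) F) (Fin n → Matrix (Fin m) (Fin k) F)}

/-- A linear map extends to a monomial one as soon as its coordinates have, up to a permutation, the
same kernels as the coordinates of the code. -/
theorem extendsToMonomial_of_ker_eq (r₀ : Fin m)
    (f : C →ₗ[Matrix (Fin m) (Fin m) F] (Fin n → Matrix (Fin m) (Fin k) F))
    (π : Equiv.Perm (Fin n))
    (h : ∀ i, LinearMap.ker (LinearMap.proj i ∘ₗ rowMap r₀ f) =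
      LinearMap.ker (LinearMap.proj (π i) ∘ₗ (rowCode C r₀).subtype)) :
    ExtendsToMonomial f := by
  choose e he using fun i => exists_linearEquiv_comp_eq_of_ker_eq _ _ (h i)
  refine ⟨LinearMap.pi fun i => (rowwiseEquiv m (e i)).toLinearMap ∘ₗ LinearMap.proj (π i),
    ⟨π, fun i => rowwiseEquiv m (e i), fun a i => rfl⟩, fun c => ?_⟩
  funext i r
  rw [← rowMap_row r₀ r f c i]
  exact (he i ⟨_, row_mem_rowCode c.2 r₀ r⟩).symm

open Classical in
/-- The isometry condition for the word with rows `w`, in terms of the kernels on the row space. -/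
theorem card_filter_rowMap_eq (r₀ : Fin m)
    (f : C →ₗ[Matrix (Fin m) (Fin m) F] (Fin n → Matrix (Fin m) (Fin k) F))
    (hf : IsHammingIsometry f) (w : Fin m → rowCode C r₀) :
    (Finset.univ.filter fun i => ∀ r,
      w r ∈ LinearMap.ker (LinearMap.proj i ∘ₗ rowMap r₀ f)).card =
    (Finset.univ.filter fun i => ∀ r,
      w r ∈ LinearMap.ker (LinearMap.proj i ∘ₗ (rowCode C r₀).subtype)).card := by
  let c : C := ⟨_, of_rows_mem r₀ w⟩
  convert (isHammingIsometry_iff f).1 hf c using 4 with i _ i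
  · refine Iff.trans (forall_congr' fun r => ?_)
      (funext_iff (f := fun r => f c i r) (g := 0)).symm
    rw [LinearMap.mem_ker, ← rowMap_row r₀ r f c i]
    rfl
  · exact (funext_iff (f := fun r => (c : Fin n → Matrix (Fin m) (Fin k) F) i r) (g := 0)).symm

open Classical in
/-- The coordinate kernels on the row space, counted positively for `f` and negatively for `C`,
cancel over any `m` vectors. If they did not match, the lower bound would give a kernel meeting
trivially a space `H` of dimension `> m`, so `m < dim H ≤ k`, and `2 * n ≥ 2 * minLength q m`. -/
theorem extendsToMonomial_of_isHammingIsometry [Fintype F] (hm : 0 < m)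
    (hn : k ≤ m ∨ n < minLength (Fintype.card F) m)
    (f : C →ₗ[Matrix (Fin m) (Fin m) F] (Fin n → Matrix (Fin m) (Fin k) F))
    (hf : IsHammingIsometry f) : ExtendsToMonomial f := by
  let r₀ : Fin m := ⟨0, hm⟩
  let p : Fin n ⊕ Fin n → (rowCode C r₀ →ₗ[F] (Fin k → F)) :=
    Sum.elim (fun i => LinearMap.proj i ∘ₗ rowMap r₀ f)
      (fun i => LinearMap.proj i ∘ₗ (rowCode C r₀).subtype)
  let s : Fin n ⊕ Fin n → ℤ := Sum.elim (fun _ => 1) (fun _ => -1)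
  suffices h : ∀ Y, ∑ i with LinearMap.ker (p i) = Y, s i = 0 by
    obtain ⟨π, hπ⟩ := exists_perm_of_card_fiber_eq
      (fun i => LinearMap.ker (LinearMap.proj i ∘ₗ rowMap r₀ f))
      (fun i => LinearMap.ker (LinearMap.proj i ∘ₗ (rowCode C r₀).subtype)) fun Y => by
        have := h Y
        rw [sum_filter_sum_type] at this
        simp only [s, p, Sum.elim_inl, Sum.elim_inr, Finset.sum_const, nsmul_eq_mul, mul_one,
          mul_neg, add_neg_eq_zero, Nat.cast_inj] at this
        exact this
    exact extendsToMonomial_of_ker_eq r₀ f π hπ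
  by_contra! hY
  obtain ⟨Y, hY⟩ := hY
  obtain ⟨H, hmH, ⟨i, hi⟩, hcard⟩ := exists_submodule_of_sum_fiber_ne_zero (m := m)
    (fun i => LinearMap.ker (p i)) s (by rintro (i | i) <;> simp [s])
    (fun w => by
      rw [sum_filter_sum_type]
      simp only [s, p, Sum.elim_inl, Sum.elim_inr, Finset.sum_const, nsmul_eq_mul, mul_one,
          mul_neg, add_neg_eq_zero, Nat.cast_inj]
      exact card_filter_rowMap_eq r₀ f hf w) Y hY
  rcases hn with hk | hn
  · have := finrank_le_of_disjoint_ker (p i) H hi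
    rw [Module.finrank_fin_fun] at this
    omega
  · have hle : ∏ j ∈ Finset.range (m + 1), (1 + Fintype.card F ^ j) ≤
        ∏ j ∈ Finset.range (Module.finrank F H), (1 + Fintype.card F ^ j) :=
      Finset.prod_le_prod_of_subset_of_one_le' (Finset.range_mono hmH) fun j _ _ => by omega
    rw [prod_range_succ_eq_two_mul_minLength] at hle
    rw [Fintype.card_sum, Fintype.card_fin] at hcard
    omega

end Extension

end MatrixModuleCode

theorem mainTheorem1 (F : Type*) [Field F] [Fintype F] (m k : ℕ) (hm : 0 < m) :
    -- if `k ≤ m`, the alphabet has the extension property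
    (k ≤ m → MatrixModuleCode.HasExtensionProperty
      (Matrix (Fin m) (Fin m) F) (Matrix (Fin m) (Fin k) F)) ∧
    -- if `k > m`, some isometry of a code of length `N` does not extend
    (m < k →
      ∃ (C : Submodule (Matrix (Fin m) (Fin m) F)
          (Fin (MatrixModuleCode.minLength (Fintype.card F) m) → Matrix (Fin m) (Fin k) F))
        (f : C →ₗ[Matrix (Fin m) (Fin m) F]
          (Fin (MatrixModuleCode.minLength (Fintype.card F) m) → Matrix (Fin m) (Fin k) F)),
        MatrixModuleCode.IsHammingIsometry f ∧ ¬ MatrixModuleCode.ExtendsToMonomial f) ∧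
    -- every isometry of a code of length `n < N` extends
    (∀ n : ℕ, n < MatrixModuleCode.minLength (Fintype.card F) m →
      ∀ (C : Submodule (Matrix (Fin m) (Fin m) F) (Fin n → Matrix (Fin m) (Fin k) F))
        (f : C →ₗ[Matrix (Fin m) (Fin m) F] (Fin n → Matrix (Fin m) (Fin k) F)),
        MatrixModuleCode.IsHammingIsometry f → MatrixModuleCode.ExtendsToMonomial f) ∧
    -- so for `k > m`, `N` is the least length of a code with an unextendable isometry
    (m < k → IsLeast
      {n : ℕ | ∃ (C : Submodule (Matrix (Fin m) (Fin m) F) (Fin n → Matrix (Fin m) (Fin k) F))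
        (f : C →ₗ[Matrix (Fin m) (Fin m) F] (Fin n → Matrix (Fin m) (Fin k) F)),
        MatrixModuleCode.IsHammingIsometry f ∧ ¬ MatrixModuleCode.ExtendsToMonomial f}
      (MatrixModuleCode.minLength (Fintype.card F) m)) := by
  have hlt : ∀ n : ℕ, n < MatrixModuleCode.minLength (Fintype.card F) m →
      ∀ (C : Submodule (Matrix (Fin m) (Fin m) F) (Fin n → Matrix (Fin m) (Fin k) F))
        (f : C →ₗ[Matrix (Fin m) (Fin m) F] (Fin n → Matrix (Fin m) (Fin k) F)),
        MatrixModuleCode.IsHammingIsometry f → MatrixModuleCode.ExtendsToMonomial f :=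
    fun _ hn _ f hf => MatrixModuleCode.extendsToMonomial_of_isHammingIsometry hm (Or.inr hn) f hf
  refine ⟨fun hk _ _ _ f hf =>
      MatrixModuleCode.extendsToMonomial_of_isHammingIsometry hm (Or.inl hk) f hf,
    MatrixModuleCode.exists_isHammingIsometry_not_extendsToMonomial hm, hlt, fun hk =>
    ⟨MatrixModuleCode.exists_isHammingIsometry_not_extendsToMonomial hm hk, ?_⟩⟩
  rintro n ⟨C, f, hf, hne⟩
  by_contra! hn
  exact hne (hlt n hn C f hf)
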